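/- Let $\mathbb{k}$ be an algebraically closed field. A finite tensor category over $\mathbb{k}$ is a $\mathbb{k}$-linear abelian rigid monoidal category whose tensor product is $\mathbb{k}$-bilinear on morphisms, in which all morphism spaces are finite-dimensional, every object has finite length, every simple object has a projective cover, there are only finitely many simple objects up to isomorphism, and $\operatorname{End}(\mathbf 1)\cong\mathbb{k}$. For an object $X$ of such a category $\mathcal{C}$, $\operatorname{FPdim}(X)$ is the largest non-negative real eigenvalue of the matrix $\big([X\otimes L_i:L_j]\big)_{j,i}$ of left multiplication by $X$ on the Grothendieck ring, where $\{L_i\}_{i\in I}$ represents the isomorphism classes of simple objects and $[\,\cdot:L_j]$ denotes Jordan–Hölder multiplicity; moreover $\operatorname{FPdim}(\mathcal{C}):=\sum_{i\in I}\operatorname{FPdim}(L_i)\operatorname{FPdim}(P_i)$, where $P_i$ is a projective cover of $L_i$. The stable category $\underline{\mathcal{C}}$ has the same objects as $\mathcal{C}$, and its morphisms are those of $\mathcal{C}$ modulo the morphisms that factor through a projective object. A $\mathbb{k}$-linear functor $F:\mathcal{C}\to\mathcal{C}'$ induces a stable equivalence if it sends projective objects to projective objects and the induced functor $\underline{F}:\underline{\mathcal{C}}\to\underline{\mathcal{C}'}$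 is an equivalence. Theorem 1.2. Let $\mathcal{C}$ and $\mathcal{C}'$ be two non-semisimple finite tensor categories over $\mathbb{k}$ having no projective simple objects and such that $\operatorname{FPdim}(\mathcal{C})=\operatorname{FPdim}(\mathcal{C}')$. Suppose $F:\mathcal{C}\to\mathcal{C}'$ is an exact $\mathbb{k}$-linear (strong) monoidal functor inducing a stable equivalence $\underline{F}:\underline{\mathcal{C}}\to\underline{\mathcal{C}'}$. Then $F$ is a tensor equivalence, that is, a $\mathbb{k}$-linear monoidal functor that is an equivalence of categories. -/

import Mathlib

open CategoryTheory CategoryTheory.Limits CategoryTheory.MonoidalCategory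

namespace FinTensor

noncomputable section

/-! ### Composition series, simple objects, projective covers -/

section Abelian

attribute [local instance] Abelian.hasFiniteBiproducts

variable {C : Type*} [Category* C] [Abelian C]

/-- `HasCompositionFactors X l`: the object `X` has a composition series (a finite filtration with
simple subquotients) whose successive subquotients, read from the top down, are the members
of the list `l`. -/
inductive HasCompositionFactors : C → List C → Prop
  | zero (X : C) : IsZero X → HasCompositionFactors X []
  | cons (S : ShortComplex C) (l : List C) : S.ShortExact → Simple S.X₃ →
      HasCompositionFactors S.X₁ l → HasCompositionFactors S.X₂ (S.X₃ :: l)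

/-- An object of finite length: it has a composition series. -/
def IsFiniteLength (X : C) : Prop := ∃ l : List C, HasCompositionFactors X l

open Classical in
/-- The Jordan-Hölder multiplicity `[X : L]`: the number of subquotients isomorphic to `L` in a
composition series of `X` (independent of the series by the Jordan-Hölder theorem). It is only
meaningful for objects `X` of finite length. -/
def multiplicity (X L : C) : ℕ :=
  if h : IsFiniteLength X then h.choose.countP (fun Y => Nonempty (Y ≅ L)) else 0

variable (C) in
/-- The set of isomorphism classes of simple objects of `C`. -/
def SimpleClass : Type _ :=
  {c : _root_.Quotient (isIsomorphicSetoid C) // Simple (_root_.Quotient.out c)}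

/-- A simple object in a given isomorphism class of simple objects. -/
def SimpleClass.rep (i : SimpleClass C) : C := _root_.Quotient.out i.1

/-- A projective cover: an epimorphism from a projective object which is essential, that is, a
morphism `g` to its source is an epimorphism as soon as the composite `g ≫ p` is. -/
structure IsProjectiveCover {P X : C} (p : P ⟶ X) : Prop where
  projective : Projective P
  epi : Epi p
  epi_of_epi_comp : ∀ {Z : C} (g : Z ⟶ P), Epi (g ≫ p) → Epi g

variable (C) in
/-- A semisimple abelian category (of objects of finite length): every object is a finite direct
sum of simple objects. -/
def IsSemisimple : Prop :=
  ∀ X : C, ∃ (n : ℕ) (S : Fin n → C), (∀ i, Simple (S i)) ∧ Nonempty (X ≅ ⨁ S)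

end Abelian

/-! ### Finite tensor categories -/

section Tensor

variable (k : Type*) [Field k] (C : Type*) [Category* C] [Abelian C] [Linear k C]
  [MonoidalCategory C] [MonoidalPreadditive C] [MonoidalLinear k C] [RigidCategory C]

/-- A `k`-linear abelian rigid monoidal category whose tensor product is bilinear on morphisms is a
finite tensor category if its morphism spaces are finite-dimensional, its objects have finite
length, its simple objects have projective covers, there are finitely many simple objects up to
isomorphism, and the unit object has endomorphism algebra `k`. -/
class IsFiniteTensorCategory : Prop where
  finiteDimensional_hom : ∀ X Y : C, FiniteDimensional k (X ⟶ Y)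
  isFiniteLength : ∀ X : C, IsFiniteLength X
  exists_projectiveCover : ∀ L : C, Simple L → ∃ (P : C) (p : P ⟶ L), IsProjectiveCover p
  finite_simpleClass : Finite (SimpleClass C)
  end_unit : Nonempty (End (𝟙_ C) ≃ₐ[k] k)

variable [IsFiniteTensorCategory k C]

/-- A projective cover `P_i` of the simple object `L_i`. -/
def projectiveCover (i : SimpleClass C) : C :=
  (IsFiniteTensorCategory.exists_projectiveCover (k := k) i.rep i.2).choose

variable {C}

/-- The matrix of left multiplication by the class of `X` on the Grothendieck ring of `C`, in the
basis of the simple objects `L_i`: the entry at `(j, i)` is the multiplicity `[X ⊗ L_i : L_j]`. -/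
def leftMulMatrix {C : Type*} [Category* C] [Abelian C] [MonoidalCategory C] (X : C) :
    Matrix (SimpleClass C) (SimpleClass C) ℝ :=
  fun j i => (multiplicity (X ⊗ i.rep) j.rep : ℝ)

open Classical in
/-- The Frobenius-Perron dimension of an object `X`: the largest non-negative real eigenvalue of
the matrix of left multiplication by `X`. -/
def FPdim (X : C) : ℝ :=
  haveI : Finite (SimpleClass C) := IsFiniteTensorCategory.finite_simpleClass (k := k)
  letI : Fintype (SimpleClass C) := Fintype.ofFinite _
  sSup {μ : ℝ | 0 ≤ μ ∧ Module.End.HasEigenvalue (Matrix.toLin' (leftMulMatrix X)) μ}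

variable (C) in
/-- The Frobenius-Perron dimension of a finite tensor category: the sum over the isomorphism classes
of simple objects `L_i` of `FPdim L_i * FPdim P_i`, with `P_i` a projective cover of `L_i`. -/
def categoryFPdim : ℝ :=
  haveI : Finite (SimpleClass C) := IsFiniteTensorCategory.finite_simpleClass (k := k)
  letI : Fintype (SimpleClass C) := Fintype.ofFinite _
  ∑ i : SimpleClass C, FPdim k i.rep * FPdim k (projectiveCover k C i)

end Tensor

/-! ### Stable categories -/

section Stable

open scoped ZeroObject

attribute [local instance] Abelian.hasFiniteBiproducts

variable (C : Type*) [Category* C] [Abelian C]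

/-- Two parallel morphisms are stably equal if their difference factors through a projective
object. -/
def stableRel : HomRel C :=
  fun X Y f g => ∃ (P : C) (_ : Projective P) (i : X ⟶ P) (j : P ⟶ Y), i ≫ j = f - g

/-- Stable equality is a congruence, so that the morphisms of the quotient category below are
exactly the classes of morphisms of `C` modulo those that factor through a projective object. -/
instance stableRel_congruence : Congruence (stableRel C) where
  equivalence {X Y} :=
    { refl := fun f => ⟨0, inferInstance, 0, 0, by simp⟩
      symm := by
        rintro f g ⟨P, hP, i, j, h⟩
        exact ⟨P, hP, -i, j, by simp [h]⟩
      trans := by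
        rintro f g e ⟨P, hP, i, j, h⟩ ⟨P', hP', i', j', h'⟩
        exact ⟨P ⊞ P', inferInstance, biprod.lift i i', biprod.desc j j', by simp [h, h']⟩ }
  comp_left := by
    rintro X Y Z f g g' ⟨P, hP, i, j, h⟩
    exact ⟨P, hP, f ≫ i, j, by simp [h]⟩
  comp_right := by
    rintro X Y Z f f' g ⟨P, hP, i, j, h⟩
    exact ⟨P, hP, i, j ≫ g, by rw [← Category.assoc, h, Preadditive.sub_comp]⟩

/-- The stable category of `C`: the objects are those of `C`, and the morphisms are the morphisms
of `C` modulo those that factor through a projective object. -/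
abbrev StableCategory : Type _ := CategoryTheory.Quotient (stableRel C)

variable {C} {D : Type*} [Category* D] [Abelian D]

/-- The functor between stable categories induced by an additive functor that sends projective
objects to projective objects. -/
def stableFunctor (F : C ⥤ D) [F.Additive] [F.PreservesProjectiveObjects] :
    StableCategory C ⥤ StableCategory D :=
  CategoryTheory.Quotient.lift (stableRel C) (F ⋙ CategoryTheory.Quotient.functor (stableRel D)) (by
    rintro X Y f g ⟨P, hP, i, j, h⟩
    refine CategoryTheory.Quotient.sound _ ⟨F.obj P, F.projective_obj P, F.map i, F.map j, ?_⟩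
    rw [← F.map_comp, h, F.map_sub])

/-- The functor `F` induces a stable equivalence: it sends projective objects to projective
objects, and the induced functor between the stable categories is an equivalence. (If `F` is
`k`-linear then so is the induced functor.) -/
def InducesStableEquivalence (F : C ⥤ D) [F.Additive] : Prop :=
  ∃ _ : F.PreservesProjectiveObjects, (stableFunctor F).IsEquivalence

end Stable

/-! ### Tensor equivalences -/

/-- A `k`-linear monoidal functor is a tensor equivalence if it is an equivalence of categories. -/
def IsTensorEquivalence (k : Type*) [Field k] {C D : Type*} [Category* C] [Category* D]
    [Abelian C] [Abelian D] [Linear k C] [Linear k D] [MonoidalCategory C] [MonoidalCategory D]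
    (F : C ⥤ D) [F.Linear k] [F.Monoidal] : Prop :=
  F.IsEquivalence

end

end FinTensor

namespace FinTensor

/-! ### Positive matrices -/

section PerronFrobenius

open Matrix

variable {n : Type*} [Fintype n]

/-! The stable equivalence enters through two facts. If `F` killed a simple object, the identity of
that object would be stably zero and the object projective; so the exact functor `F` kills no simple
object and is faithful. A simple object `L` of `C'` is stably isomorphic to some `F X`, and a
representative `F X ⟶ L` is nonzero because `L` is not projective, hence epi; lifting through
projectives, every object of `C'` is a quotient of some `F X`.

The rest is a count of dimensions. Perron's theorem yields a multiplicative additive function `d` on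
`C'`; it computes `FPdim`, and `d ∘ F` computes `FPdim` on `C`. Let R be the formal sum of the P_i
with weights FPdim L_i. By duality, u(Y) = dim Hom(F R, Y) satisfies u(Y ⊗ F X) = d(F X) u(Y), just
as `d` does. Some `F Z` acts by a positive matrix, whose Perron eigenspace is a line, so u = c d
(`exists_regularHomDim_eq`). Taking dimensions of F R gives FPdim(C) = c FPdim(C'), so c = 1. Then
dim Hom(F R, F X) = d(F X) = dim Hom(R, X), which forces each injection Hom(P_i, X) → Hom(F P_i, F
X) to be bijective (`surjective_map_of_projective`). Projective presentations now make `F` full, and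
presentations by objects `F X` make it essentially surjective. -/

theorem mulVec_pos_of_pos {A : Matrix n n ℝ} (hA : ∀ i j, 0 < A i j) {v : n → ℝ}
    (hv : ∀ i, 0 ≤ v i) (hv' : v ≠ 0) (i : n) : 0 < (A *ᵥ v) i := by
  obtain ⟨j, hj⟩ := Function.ne_iff.1 hv'
  exact Finset.sum_pos' (fun l _ => mul_nonneg (hA i l).le (hv l))
    ⟨j, Finset.mem_univ j, mul_pos (hA i j) (lt_of_le_of_ne (hv j) (Ne.symm hj))⟩

/-- Perron's theorem: a matrix with positive entries has a positive eigenvector. -/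
theorem exists_pos_eigenvector [Nonempty n] {A : Matrix n n ℝ} (hA : ∀ i j, 0 < A i j) :
    ∃ (w : n → ℝ) (r : ℝ), (∀ i, 0 < w i) ∧ A *ᵥ w = r • w := by
  classical
  -- Collatz-Wielandt: the largest `t` with `t • x ≤ A *ᵥ x` for some `x` in the simplex is
  -- attained, and a maximiser will be an eigenvector.
  let K : Set (ℝ × (n → ℝ)) :=
    {p | p.2 ∈ stdSimplex ℝ n ∧ 0 ≤ p.1 ∧ ∀ i, p.1 * p.2 i ≤ (A *ᵥ p.2) i}
  have hclosed : IsClosed K := by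
    have h1 : IsClosed {p : ℝ × (n → ℝ) | p.2 ∈ stdSimplex ℝ n} :=
      (isClosed_stdSimplex (𝕜 := ℝ) n).preimage continuous_snd
    have h2 : IsClosed {p : ℝ × (n → ℝ) | 0 ≤ p.1} := isClosed_le continuous_const continuous_fst
    have h3 : IsClosed {p : ℝ × (n → ℝ) | ∀ i, p.1 * p.2 i ≤ (A *ᵥ p.2) i} := by
      rw [Set.ofPred_forall]
      refine isClosed_iInter fun i => isClosed_le (by fun_prop) ?_
      simp only [Matrix.mulVec, dotProduct]
      fun_prop
    exact h1.inter (h2.inter h3)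
  have hsub : K ⊆ Set.Icc 0 (∑ i, ∑ j, A i j) ×ˢ stdSimplex ℝ n := by
    rintro ⟨t, x⟩ ⟨hx, ht, h⟩
    refine ⟨⟨ht, ?_⟩, hx⟩
    calc t = ∑ i, t * x i := by rw [← Finset.mul_sum, hx.2, mul_one]
      _ ≤ ∑ i, (A *ᵥ x) i := Finset.sum_le_sum fun i _ => h i
      _ ≤ ∑ i, ∑ j, A i j := by
        refine Finset.sum_le_sum fun i _ => Finset.sum_le_sum fun j _ => ?_
        exact mul_le_of_le_one_right (hA i j).le
          (hx.2 ▸ Finset.single_le_sum (fun l _ => hx.1 l) (Finset.mem_univ j))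
  have hcomp : IsCompact K :=
    (isCompact_Icc.prod (isCompact_stdSimplex ℝ n)).of_isClosed_subset hclosed hsub
  have hne : K.Nonempty := by
    obtain ⟨i⟩ := ‹Nonempty n›
    refine ⟨(0, Pi.single i 1), single_mem_stdSimplex ℝ i, le_rfl, fun j => ?_⟩
    simpa using (hA j i).le
  obtain ⟨⟨t, x⟩, ⟨hx, ht, htx⟩, hmax⟩ := hcomp.exists_isMaxOn hne continuous_fst.continuousOn
  simp only at hx ht htx
  have hx0 : x ≠ 0 := by
    rintro rfl
    simpa using hx.2
  have hy : ∀ i, 0 < (A *ᵥ x) i := mulVec_pos_of_pos hA hx.1 hx0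
  -- Otherwise applying `A` to the nonzero nonnegative vector `A *ᵥ x - t • x` makes every
  -- inequality strict for `y = A *ᵥ x`, so `y`, normalised, admits a larger `t`.
  have heq : A *ᵥ x = t • x := by
    by_contra hcon
    have hz : ∀ i, 0 < (A *ᵥ (A *ᵥ x - t • x)) i :=
      mulVec_pos_of_pos hA (fun i => by simpa using htx i) (sub_ne_zero.2 hcon)
    simp only [Matrix.mulVec_sub, Matrix.mulVec_smul, Pi.sub_apply, Pi.smul_apply, smul_eq_mul,
      sub_pos] at hz
    set y := A *ᵥ x with hydef
    obtain ⟨i₁, -, hi₁⟩ := Finset.exists_min_image Finset.univ (fun i => (A *ᵥ y) i / y i)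
      Finset.univ_nonempty
    have hs : 0 < ∑ i, y i := Finset.sum_pos (fun i _ => hy i) Finset.univ_nonempty
    have hlt : t < (A *ᵥ y) i₁ / y i₁ := (lt_div_iff₀ (hy i₁)).2 (hz i₁)
    have hmem : ((A *ᵥ y) i₁ / y i₁, (∑ i, y i)⁻¹ • y) ∈ K := by
      refine ⟨⟨fun i => ?_, ?_⟩, ht.trans hlt.le, fun i => ?_⟩
      · exact mul_nonneg (inv_nonneg.2 hs.le) (hy i).le
      · simp only [Pi.smul_apply, smul_eq_mul]
        rw [← Finset.mul_sum, inv_mul_cancel₀ hs.ne']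
      · simp only [Matrix.mulVec_smul, Pi.smul_apply, smul_eq_mul]
        rw [mul_left_comm]
        exact mul_le_mul_of_nonneg_left ((le_div_iff₀ (hy i)).1 (hi₁ i (Finset.mem_univ i)))
          (inv_nonneg.2 hs.le)
    exact absurd (hmax hmem) (not_le.2 hlt)
  refine ⟨x, t, fun i => ?_, heq⟩
  have := hy i
  rw [heq, Pi.smul_apply, smul_eq_mul] at this
  exact pos_of_mul_pos_right this ht

/-- The eigenspace of a positive matrix containing a positive eigenvector is a line. -/
theorem eq_smul_of_pos_eigenvector {A : Matrix n n ℝ} (hA : ∀ i j, 0 < A i j) {w u : n → ℝ}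
    {r : ℝ} (hw : ∀ i, 0 < w i) (hAw : A *ᵥ w = r • w) (hAu : A *ᵥ u = r • u) :
    ∃ c : ℝ, u = c • w := by
  cases isEmpty_or_nonempty n
  · exact ⟨0, Subsingleton.elim _ _⟩
  obtain ⟨i₁, -, hi₁⟩ := Finset.exists_min_image Finset.univ (fun i => u i / w i)
    Finset.univ_nonempty
  -- With the minimal ratio as constant, `u - c • w` is nonnegative and vanishes at `i₁`; were it
  -- nonzero, `A` would make this coordinate positive, yet `A` only scales it by `r`.
  refine ⟨u i₁ / w i₁, sub_eq_zero.1 (by_contra fun hne => ?_)⟩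
  have h := mulVec_pos_of_pos hA (v := u - (u i₁ / w i₁) • w)
    (fun i => by simpa using (le_div_iff₀ (hw i)).1 (hi₁ i (Finset.mem_univ i))) hne i₁
  rw [Matrix.mulVec_sub, Matrix.mulVec_smul, hAw, hAu] at h
  have := (hw i₁).ne'
  simp only [Pi.sub_apply, Pi.smul_apply, smul_eq_mul] at h
  field_simp at h
  simp at h

/-- The eigenvalue of a positive left eigenvector of a nonnegative matrix is its largest
nonnegative eigenvalue. -/
theorem isGreatest_eigenvalue_of_pos_vecMul [DecidableEq n] [Nonempty n] {N : Matrix n n ℝ}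
    (hN : ∀ i j, 0 ≤ N i j) {w : n → ℝ} {r : ℝ} (hw : ∀ i, 0 < w i) (hwN : w ᵥ* N = r • w) :
    IsGreatest {μ : ℝ | 0 ≤ μ ∧ Module.End.HasEigenvalue (Matrix.toLin' N) μ} r := by
  have hr : 0 ≤ r := by
    obtain ⟨i⟩ := ‹Nonempty n›
    have h : 0 ≤ (w ᵥ* N) i := Finset.sum_nonneg fun j _ => mul_nonneg (hw j).le (hN j i)
    rw [hwN, Pi.smul_apply, smul_eq_mul] at h
    exact nonneg_of_mul_nonneg_left h (hw i)
  refine ⟨⟨hr, ?_⟩, ?_⟩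
  -- A matrix and its transpose have the same characteristic polynomial.
  · have h : Module.End.HasEigenvalue (Matrix.toLin' Nᵀ) r := by
      refine Module.End.hasEigenvalue_of_hasEigenvector (x := w) ⟨?_, fun h0 => ?_⟩
      · rw [Module.End.mem_eigenspace_iff, Matrix.toLin'_apply, Matrix.mulVec_transpose, hwN]
      · obtain ⟨i⟩ := ‹Nonempty n›
        exact (hw i).ne' (congrFun h0 i)
    rw [Module.End.hasEigenvalue_iff_isRoot_charpoly] at h ⊢
    rwa [Matrix.charpoly_toLin', Matrix.charpoly_transpose, ← Matrix.charpoly_toLin'] at h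
  · rintro μ ⟨hμ, hev⟩
    obtain ⟨v, hv⟩ := hev.exists_hasEigenvector
    have hNv : N *ᵥ v = μ • v := by
      simpa [Matrix.toLin'_apply] using hv.apply_eq_smul
    -- Pairing `μ • |v| ≤ N *ᵥ |v|` with `w` bounds `μ` by `r`.
    have hpos : 0 < w ⬝ᵥ |v| := by
      obtain ⟨j, hj⟩ := Function.ne_iff.1 hv.2
      exact Finset.sum_pos' (fun l _ => mul_nonneg (hw l).le (abs_nonneg _))
        ⟨j, Finset.mem_univ j, mul_pos (hw j) (abs_pos.2 hj)⟩
    refine le_of_mul_le_mul_right ?_ hpos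
    calc μ * (w ⬝ᵥ |v|) = w ⬝ᵥ (μ • |v|) := by rw [dotProduct_smul, smul_eq_mul]
      _ ≤ w ⬝ᵥ (N *ᵥ |v|) := by
        refine Finset.sum_le_sum fun i _ => mul_le_mul_of_nonneg_left ?_ (hw i).le
        have : μ * |v i| = |(N *ᵥ v) i| := by
          rw [hNv, Pi.smul_apply, smul_eq_mul, abs_mul, abs_of_nonneg hμ]
        simp only [Pi.smul_apply, smul_eq_mul, Pi.abs_apply, this]
        refine (Finset.abs_sum_le_sum_abs _ _).trans_eq (Finset.sum_congr rfl fun j _ => ?_)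
        rw [abs_mul, abs_of_nonneg (hN i j), Pi.abs_apply]
      _ = r * (w ⬝ᵥ |v|) := by
        rw [Matrix.dotProduct_mulVec, hwN, smul_dotProduct, smul_eq_mul]

end PerronFrobenius

end FinTensor

namespace FinTensor

open Module

/-! ### Additive functions on abelian categories -/

section Additive

variable {C : Type*} [Category* C] [Abelian C]

/-- A real-valued function on objects which is additive on short exact sequences. -/
def IsAdditiveOnObjects (φ : C → ℝ) : Prop :=
  ∀ S : ShortComplex C, S.ShortExact → φ S.X₂ = φ S.X₁ + φ S.X₃

theorem shortExact_of_isIso {X Y Z : C} (hX : IsZero X) (e : Y ≅ Z) :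
    (ShortComplex.mk (0 : X ⟶ Y) e.hom zero_comp).ShortExact where
  exact := (ShortComplex.exact_iff_mono _ rfl).2 (inferInstanceAs (Mono e.hom))
  mono_f := ⟨fun _ _ _ => hX.eq_of_tgt _ _⟩
  epi_g := inferInstanceAs (Epi e.hom)

theorem shortExact_biprod (X Y : C) :
    (ShortComplex.mk (biprod.inl : X ⟶ X ⊞ Y) biprod.snd biprod.inl_snd).ShortExact :=
  (ShortComplex.Splitting.ofHasBinaryBiproduct X Y).shortExact

theorem shortExact_of_epi {X Y : C} (f : X ⟶ Y) [Epi f] :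
    (ShortComplex.mk (kernel.ι f) f (kernel.condition f)).ShortExact where
  exact := ShortComplex.exact_kernel f

namespace IsAdditiveOnObjects

variable {φ : C → ℝ} (h : IsAdditiveOnObjects φ)

include h

theorem eq_zero_of_isZero {X : C} (hX : IsZero X) : φ X = 0 := by
  simpa using h _ (shortExact_of_isIso hX (Iso.refl X))

theorem eq_of_iso {X Y : C} (e : X ≅ Y) : φ X = φ Y := by
  simpa [h.eq_zero_of_isZero (isZero_zero C)] using h _ (shortExact_of_isIso (isZero_zero C) e)

theorem biprod (X Y : C) : φ (X ⊞ Y) = φ X + φ Y := h _ (shortExact_biprod X Y)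

end IsAdditiveOnObjects

theorem IsAdditiveOnObjects.comp {D : Type*} [Category* D] [Abelian D] {φ : D → ℝ}
    (h : IsAdditiveOnObjects φ) (F : C ⥤ D) [F.PreservesZeroMorphisms] [PreservesFiniteLimits F]
    [PreservesFiniteColimits F] : IsAdditiveOnObjects fun X => φ (F.obj X) :=
  fun _ hS => h _ (hS.map_of_exact F)

end Additive

/-! ### Simple quotients -/

section Simple

variable {C : Type*} [Category* C] [Abelian C]

theorem IsFiniteLength.isZero_or_exists_epi {X : C} (hX : IsFiniteLength X) :
    IsZero X ∨ ∃ (L : C) (_ : Simple L) (f : X ⟶ L), Epi f := by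
  obtain ⟨l, hl⟩ := hX
  cases hl with
  | zero _ h => exact Or.inl h
  | cons S l hS h _ => exact Or.inr ⟨_, h, S.g, hS.epi_g⟩

instance SimpleClass.simple_rep (i : SimpleClass C) : Simple i.rep := i.2

theorem SimpleClass.exists_iso_rep (L : C) [Simple L] :
    ∃ i : SimpleClass C, Nonempty (i.rep ≅ L) := by
  have e : Nonempty (_root_.Quotient.out (s := isIsomorphicSetoid C) ⟦L⟧ ≅ L) :=
    _root_.Quotient.mk_out (s := isIsomorphicSetoid C) L
  obtain ⟨e⟩ := e
  exact ⟨⟨⟦L⟧, Simple.of_iso e⟩, ⟨e⟩⟩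

theorem SimpleClass.eq_of_iso {i j : SimpleClass C} (e : i.rep ≅ j.rep) : i = j := by
  have h := _root_.Quotient.sound (s := isIsomorphicSetoid C) ⟨e⟩
  exact Subtype.ext (by simpa only [SimpleClass.rep, _root_.Quotient.out_eq] using h)

/-- A nonzero morphism from a projective cover of a simple object to a simple object factors
through the cover via an isomorphism. -/
theorem IsProjectiveCover.exists_iso_of_ne_zero {P L L' : C} [Simple L] [Simple L'] {p : P ⟶ L}
    (hp : IsProjectiveCover p) {f : P ⟶ L'} (hf : f ≠ 0) : ∃ e : L ≅ L', p ≫ e.hom = f := by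
  have := epi_of_nonzero_to_simple hf
  have := hp.epi
  have hp0 : p ≠ 0 := fun h => id_nonzero L (by rw [← cancel_epi p, h, zero_comp, zero_comp])
  -- Either `p` factors through `f`, by a nonzero map of simple objects, or the kernel of `f` maps
  -- onto `L`; then essentiality makes `kernel.ι f` epi and `f` zero.
  by_cases h : kernel.ι f ≫ p = 0
  · let g : L' ⟶ L := Abelian.epiDesc f p h
    have hg : f ≫ g = p := Abelian.comp_epiDesc f p h
    have : IsIso g := isIso_of_hom_simple fun h0 => hp0 (by rw [← hg, h0, comp_zero])
    exact ⟨(asIso g).symm, by simp [← hg]⟩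
  · have := hp.epi_of_epi_comp (kernel.ι f) (epi_of_nonzero_to_simple h)
    exact absurd (by rw [← cancel_epi (kernel.ι f), kernel.condition, comp_zero]) hf

end Simple

/-! ### Dimensions of morphism spaces -/

section Hom

variable (k : Type*) [Field k] {C : Type*} [Category* C] [Abelian C] [Linear k C]

theorem finrank_hom_congr {X X' Y Y' : C} (e : X ≅ X') (e' : Y ≅ Y') :
    finrank k (X ⟶ Y) = finrank k (X' ⟶ Y') :=
  (Linear.homCongr k e e').finrank_eq

theorem finrank_hom_biprod [∀ X Y : C, FiniteDimensional k (X ⟶ Y)] (X X' Y : C) :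
    finrank k (X ⊞ X' ⟶ Y) = finrank k (X ⟶ Y) + finrank k (X' ⟶ Y) := by
  rw [← Module.finrank_prod]
  refine LinearEquiv.finrank_eq
    { toFun := fun f => (biprod.inl ≫ f, biprod.inr ≫ f)
      invFun := fun f => biprod.desc f.1 f.2
      map_add' := fun f g => by simp
      map_smul' := fun r f => by simp
      left_inv := fun f => by ext <;> simp
      right_inv := fun f => by ext <;> simp }

theorem finrank_hom_eq_zero {X Y : C} (hY : IsZero Y) : finrank k (X ⟶ Y) = 0 := by
  have : Subsingleton (X ⟶ Y) := ⟨fun _ _ => hY.eq_of_tgt _ _⟩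
  exact Module.finrank_zero_of_subsingleton

variable [∀ X Y : C, FiniteDimensional k (X ⟶ Y)]

theorem finrank_hom_of_shortExact (P : C) [Projective P] {S : ShortComplex C} (hS : S.ShortExact) :
    finrank k (P ⟶ S.X₂) = finrank k (P ⟶ S.X₁) + finrank k (P ⟶ S.X₃) := by
  have := hS.mono_f
  have := hS.epi_g
  let a : (P ⟶ S.X₁) →ₗ[k] (P ⟶ S.X₂) := Linear.rightComp k P S.f
  let b : (P ⟶ S.X₂) →ₗ[k] (P ⟶ S.X₃) := Linear.rightComp k P S.g
  have ha : Function.Injective a := fun f g h => (cancel_mono S.f).1 h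
  have hb : Function.Surjective b := fun f =>
    ⟨Projective.factorThru f S.g, Projective.factorThru_comp f S.g⟩
  have hab : LinearMap.range a = LinearMap.ker b := by
    ext f
    constructor
    · rintro ⟨g, rfl⟩
      simp [a, b]
    · intro hf
      exact ⟨hS.exact.lift f hf, hS.exact.lift_f f hf⟩
  rw [← LinearMap.finrank_range_add_finrank_ker b, ← hab, LinearMap.finrank_range_of_inj ha,
    LinearMap.range_eq_top.2 hb, finrank_top, add_comm]

theorem isAdditiveOnObjects_finrank_hom (P : C) [Projective P] :
    IsAdditiveOnObjects fun X : C => (finrank k (P ⟶ X) : ℝ) := fun S hS => by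
  simp only [finrank_hom_of_shortExact k P hS, Nat.cast_add]

theorem finrank_hom_pos {X Y : C} {f : X ⟶ Y} (hf : f ≠ 0) : 0 < finrank k (X ⟶ Y) :=
  Module.finrank_pos_iff_exists_ne_zero.2 ⟨f, hf⟩

variable [IsAlgClosed k]

open Classical in
theorem IsProjectiveCover.finrank_hom {P L : C} [Simple L] {p : P ⟶ L}
    (hp : IsProjectiveCover p) (L' : C) [Simple L'] :
    finrank k (P ⟶ L') = if Nonempty (L ≅ L') then 1 else 0 := by
  rw [← finrank_hom_simple_simple k L L']
  have := hp.epi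
  symm
  refine LinearEquiv.finrank_eq (LinearEquiv.ofBijective (Linear.leftComp k L' p) ⟨?_, ?_⟩)
  · exact fun f g h => (cancel_epi p).1 h
  · intro f
    by_cases hf : f = 0
    · exact ⟨0, by simp [hf]⟩
    · obtain ⟨e, he⟩ := hp.exists_iso_of_ne_zero hf
      exact ⟨e.hom, he⟩

open Classical in
-- Hom(P, -) is additive and takes dimension 1 on factors isomorphic to `L` and 0 on the others. In
-- particular the count does not depend on the series.
theorem HasCompositionFactors.countP_eq {P L : C} [Simple L] {p : P ⟶ L}
    (hp : IsProjectiveCover p) {X : C} {l : List C} (h : HasCompositionFactors X l) :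
    l.countP (fun Y => Nonempty (Y ≅ L)) = finrank k (P ⟶ X) := by
  have := hp.projective
  induction h with
  | zero X hX => rw [List.countP_nil, finrank_hom_eq_zero k hX]
  | cons S l hS hL _ ih =>
    rw [List.countP_cons, ih, finrank_hom_of_shortExact k P hS, hp.finrank_hom k S.X₃]
    have : Nonempty (S.X₃ ≅ L) ↔ Nonempty (L ≅ S.X₃) :=
      ⟨fun ⟨e⟩ => ⟨e.symm⟩, fun ⟨e⟩ => ⟨e.symm⟩⟩
    simp only [this, decide_eq_true_eq]

theorem multiplicity_eq_finrank {P L : C} [Simple L] {p : P ⟶ L} (hp : IsProjectiveCover p)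
    {X : C} (hX : IsFiniteLength X) : multiplicity X L = finrank k (P ⟶ X) := by
  rw [multiplicity, dif_pos hX]
  exact hX.choose_spec.countP_eq k hp

end Hom

end FinTensor

namespace FinTensor

noncomputable section

open Module Functor.LaxMonoidal Functor.OplaxMonoidal

/-! ### Exactness of the tensor product and duality -/

section Rigid

variable {C : Type*} [Category* C] [MonoidalCategory C] [RigidCategory C]

/-- Duals on both sides give each tensoring functor adjoints on both sides, hence exactness. -/
instance (X : C) : (tensorRight X).IsLeftAdjoint := (tensorRightAdjunction X (Xᘁ)).isLeftAdjoint

instance (X : C) : (tensorRight X).IsRightAdjoint := (tensorRightAdjunction (ᘁX) X).isRightAdjoint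

instance (X : C) : (tensorLeft X).IsLeftAdjoint := (tensorLeftAdjunction (ᘁX) X).isLeftAdjoint

instance (X : C) : (tensorLeft X).IsRightAdjoint := (tensorLeftAdjunction X (Xᘁ)).isRightAdjoint

instance (X : C) : PreservesFiniteLimits (tensorRight X) :=
  ⟨fun _ _ _ => inferInstance⟩

end Rigid

/-- A strong monoidal functor sends exact pairings to exact pairings. -/
abbrev exactPairingMap {C D : Type*} [Category* C] [Category* D] [MonoidalCategory C]
    [MonoidalCategory D] (F : C ⥤ D) [F.Monoidal] (X Y : C) [ExactPairing X Y] :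
    ExactPairing (F.obj X) (F.obj Y) where
  coevaluation' := ε F ≫ F.map (η_ X Y) ≫ δ F X Y
  evaluation' := μ F Y X ≫ F.map (ε_ X Y) ≫ η F
  coevaluation_evaluation' := by
    -- The unitors are written as images under `F`, so that the zigzag identity of the original
    -- pairing can be inserted.
    have h : (ρ_ (F.obj Y)).hom ≫ (λ_ (F.obj Y)).inv = F.obj Y ◁ ε F ≫ μ F Y (𝟙_ C) ≫
        F.map (ρ_ Y).hom ≫ F.map (λ_ Y).inv ≫ δ F (𝟙_ C) Y ≫ η F ▷ F.obj Y := by simp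
    rw [h, ← F.map_comp_assoc, ← ExactPairing.coevaluation_evaluation X Y, F.map_comp, F.map_comp,
      Functor.Monoidal.map_whiskerLeft, Functor.Monoidal.map_whiskerRight,
      Functor.Monoidal.map_associator_inv]
    simp only [Category.assoc, Functor.Monoidal.μ_δ_assoc, MonoidalCategory.whiskerLeft_comp,
      comp_whiskerRight]
  evaluation_coevaluation' := by
    have h : (λ_ (F.obj X)).hom ≫ (ρ_ (F.obj X)).inv = ε F ▷ F.obj X ≫ μ F (𝟙_ C) X ≫
        F.map (λ_ X).hom ≫ F.map (ρ_ X).inv ≫ δ F X (𝟙_ C) ≫ F.obj X ◁ η F := by simp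
    rw [h, ← F.map_comp_assoc, ← ExactPairing.evaluation_coevaluation X Y, F.map_comp, F.map_comp,
      Functor.Monoidal.map_whiskerLeft, Functor.Monoidal.map_whiskerRight,
      Functor.Monoidal.map_associator]
    simp only [Category.assoc, Functor.Monoidal.μ_δ_assoc, MonoidalCategory.whiskerLeft_comp,
      comp_whiskerRight]

section

variable (k : Type*) [Field k] {C : Type*} [Category* C] [Abelian C] [Linear k C]
  [MonoidalCategory C] [MonoidalPreadditive C] [MonoidalLinear k C]

theorem finrank_hom_tensor (X Y Y' Z : C) [ExactPairing Y Y'] :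
    finrank k (X ⊗ Y ⟶ Z) = finrank k (X ⟶ Z ⊗ Y') :=
  LinearEquiv.finrank_eq
    { tensorRightHomEquiv X Y Y' Z with
      map_add' := fun f g => by simp [tensorRightHomEquiv]
      map_smul' := fun r f => by simp [tensorRightHomEquiv] }

variable [RigidCategory C]

theorem isAdditiveOnObjects_tensor_right {φ : C → ℝ} (h : IsAdditiveOnObjects φ) (X : C) :
    IsAdditiveOnObjects fun Y => φ (Y ⊗ X) :=
  h.comp (tensorRight X)

theorem isAdditiveOnObjects_tensor_left {φ : C → ℝ} (h : IsAdditiveOnObjects φ) (X : C) :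
    IsAdditiveOnObjects fun Y => φ (X ⊗ Y) :=
  h.comp (tensorLeft X)

/-- Tensoring with `X` is left adjoint to tensoring with a dual, which preserves epimorphisms. -/
instance projective_tensor (P X : C) [Projective P] : Projective (P ⊗ X) :=
  (tensorRightAdjunction X (Xᘁ)).map_projective P inferInstance

end

/-! ### The unit object is simple -/

section Unit

variable {C : Type*} [Category* C] [Abelian C] [MonoidalCategory C] [MonoidalPreadditive C]

theorem evaluation_ne_zero {X Y : C} [ExactPairing X Y] (hY : ¬ IsZero Y) : ε_ X Y ≠ 0 := by
  intro h
  have h1 := ExactPairing.coevaluation_evaluation X Y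
  rw [h, MonoidalPreadditive.zero_whiskerRight, comp_zero, comp_zero] at h1
  refine hY ((IsZero.iff_id_eq_zero _).2 ?_)
  have h2 : 𝟙 Y = (ρ_ Y).inv ≫ ((ρ_ Y).hom ≫ (λ_ Y).inv) ≫ (λ_ Y).hom := by simp
  rw [h2, ← h1, zero_comp, comp_zero]

/-- The zigzag identity recovers `a` from its mate `Y ⊗ A ⟶ 𝟙_ C`. -/
theorem eq_zero_of_whiskerLeft_comp_evaluation {A X Y : C} [ExactPairing X Y] {a : A ⟶ X}
    (h : Y ◁ a ≫ ε_ X Y = 0) : a = 0 := by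
  have h1 : (λ_ A).inv ≫ η_ X Y ▷ A ≫ (α_ X Y A).hom ≫ X ◁ (Y ◁ a ≫ ε_ X Y) ≫ (ρ_ X).hom = a := by
    calc
      _ = 𝟙 _ ⊗≫ (η_ X Y ▷ A ≫ (X ⊗ Y) ◁ a) ⊗≫ X ◁ ε_ X Y ⊗≫ 𝟙 _ := by monoidal
      _ = 𝟙 _ ⊗≫ a ⊗≫ (η_ X Y ▷ X ⊗≫ X ◁ ε_ X Y) ⊗≫ 𝟙 _ := by
        rw [← whisker_exchange]; monoidal
      _ = a := by rw [ExactPairing.evaluation_coevaluation'']; monoidal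
  rw [← h1, h, MonoidalPreadditive.whiskerLeft_zero, zero_comp, comp_zero, comp_zero, comp_zero]

end Unit

section FiniteTensor

variable (k : Type*) [Field k] {C : Type*} [Category* C] [Abelian C] [Linear k C]
  [MonoidalCategory C] [IsFiniteTensorCategory k C]

include k in
theorem isIso_of_end_unit_ne_zero {f : 𝟙_ C ⟶ 𝟙_ C} (hf : f ≠ 0) : IsIso f := by
  obtain ⟨e⟩ := IsFiniteTensorCategory.end_unit (k := k) (C := C)
  let f' : End (𝟙_ C) := f
  have h : e f' ≠ 0 := by
    rw [Ne, map_eq_zero_iff e e.injective]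
    exact hf
  have hu : IsUnit f' := (isUnit_iff_ne_zero.2 h).of_map e
  exact (isUnit_iff_isIso f').1 hu

include k in
theorem not_isZero_unit : ¬ IsZero (𝟙_ C) := by
  intro h
  obtain ⟨e⟩ := IsFiniteTensorCategory.end_unit (k := k) (C := C)
  have h1 : (1 : End (𝟙_ C)) = 0 := h.eq_of_src _ _
  exact one_ne_zero (by rw [← map_one e, h1, map_zero])

variable [MonoidalPreadditive C] [RigidCategory C]

include k in
-- For a simple quotient `p : 𝟙_ C ⟶ X`, the dual map `m : ᘁX ⟶ 𝟙_ C` is mono, so `X ⊗ ᘁX` embeds in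
-- `X` and is isomorphic to it. Following `p` by this isomorphism and evaluation gives a nonzero,
-- hence invertible, endomorphism of the unit; so `p` is an isomorphism.
theorem simple_unit : Simple (𝟙_ C) := by
  obtain h | ⟨X, _, p, _⟩ :=
    (IsFiniteTensorCategory.isFiniteLength (k := k) (𝟙_ C)).isZero_or_exists_epi
  · exact absurd h (not_isZero_unit k)
  have hX : ¬ IsZero X := Simple.not_isZero X
  have hε := evaluation_ne_zero (X := ᘁX) hX
  let m : (ᘁX) ⟶ 𝟙_ C := (λ_ (ᘁX)).inv ≫ p ▷ (ᘁX) ≫ ε_ (ᘁX) X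
  have hpe (A : C) : Epi (p ▷ A) := inferInstanceAs (Epi ((tensorRight A).map p))
  have : Mono m := by
    refine Preadditive.mono_of_cancel_zero _ fun {A} a ha => ?_
    have h : (λ_ A).inv ≫ p ▷ A ≫ X ◁ a ≫ ε_ (ᘁX) X = 0 := by
      rw [← ha, ← whisker_exchange_assoc]
      simp [m]
    refine eq_zero_of_whiskerLeft_comp_evaluation (Y := X) ?_
    rw [← cancel_epi (p ▷ A), ← cancel_epi (λ_ A).inv, h, comp_zero, comp_zero]
  have : Mono (X ◁ m) := inferInstanceAs (Mono ((tensorLeft X).map m))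
  let q : X ⊗ (ᘁX) ⟶ X := X ◁ m ≫ (ρ_ X).hom
  have hq : q ≠ 0 := fun h => hε (by
    have h2 : 𝟙 (X ⊗ (ᘁX)) = 0 := by rw [← cancel_mono q, h, comp_zero, comp_zero]
    rw [← Category.id_comp (ε_ (ᘁX) X), h2, zero_comp])
  have : IsIso q := isIso_of_mono_of_nonzero hq
  have hc : p ≫ inv q ≫ ε_ (ᘁX) X ≠ 0 := fun h => hε (by
    rw [← cancel_epi (inv q), ← cancel_epi p, h, comp_zero, comp_zero])
  have := isIso_of_end_unit_ne_zero k hc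
  have : Mono p := mono_of_mono p (inv q ≫ ε_ (ᘁX) X)
  have : IsIso p := isIso_of_mono_of_epi p
  exact Simple.of_iso (asIso p)

include k in
-- If `P` is a projective cover of the unit, then `P ⊗ X` is projective and maps onto `X`.
theorem enoughProjectives : EnoughProjectives C := by
  refine ⟨fun X => ?_⟩
  have := simple_unit k (C := C)
  obtain ⟨P, p, hp⟩ :=
    IsFiniteTensorCategory.exists_projectiveCover (k := k) (𝟙_ C) inferInstance
  have := hp.projective
  have := hp.epi
  have : Epi (p ▷ X) := inferInstanceAs (Epi ((tensorRight X).map p))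
  exact ⟨⟨P ⊗ X, p ▷ X ≫ (λ_ X).hom⟩⟩

end FiniteTensor

end

end FinTensor

namespace FinTensor

noncomputable section

open Module

/-! ### Multiplicities and projective covers in finite tensor categories -/

section Multiplicity

variable (k : Type*) [Field k] {C : Type*} [Category* C] [Abelian C] [Linear k C]
  [MonoidalCategory C] [IsFiniteTensorCategory k C]

theorem exists_isProjectiveCover (i : SimpleClass C) :
    ∃ p : projectiveCover k C i ⟶ i.rep, IsProjectiveCover p :=
  (IsFiniteTensorCategory.exists_projectiveCover (k := k) i.rep i.2).choose_spec

instance projective_projectiveCover (i : SimpleClass C) : Projective (projectiveCover k C i) :=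
  (exists_isProjectiveCover k i).choose_spec.projective

theorem not_isZero_projectiveCover (i : SimpleClass C) : ¬ IsZero (projectiveCover k C i) := by
  obtain ⟨p, hp⟩ := exists_isProjectiveCover k i
  have := hp.epi
  exact fun h => Simple.not_isZero i.rep (h.of_epi p)

include k in
theorem nonempty_simpleClass [MonoidalPreadditive C] [RigidCategory C] :
    Nonempty (SimpleClass C) := by
  have := simple_unit k (C := C)
  exact ⟨(SimpleClass.exists_iso_rep (𝟙_ C)).choose⟩

variable [IsAlgClosed k]

theorem multiplicity_rep (X : C) (i : SimpleClass C) :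
    multiplicity X i.rep = finrank k (projectiveCover k C i ⟶ X) := by
  have := IsFiniteTensorCategory.finiteDimensional_hom (k := k) (C := C)
  exact multiplicity_eq_finrank k (exists_isProjectiveCover k i).choose_spec
    (IsFiniteTensorCategory.isFiniteLength (k := k) X)

include k in
theorem multiplicity_rep_pos_of_epi {X : C} {i : SimpleClass C} (f : X ⟶ i.rep) [Epi f] :
    0 < multiplicity X i.rep := by
  have := IsFiniteTensorCategory.finiteDimensional_hom (k := k) (C := C)
  obtain ⟨p, hp⟩ := exists_isProjectiveCover k i
  have := hp.epi
  rw [multiplicity_rep k]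
  refine finrank_hom_pos k (f := Projective.factorThru p f) fun h => Simple.not_isZero i.rep ?_
  have hp0 : p = 0 := by rw [← Projective.factorThru_comp p f, h, zero_comp]
  exact IsZero.of_epi_eq_zero p hp0

open Classical in
theorem finrank_projectiveCover_rep (i j : SimpleClass C) :
    finrank k (projectiveCover k C i ⟶ j.rep) = if i = j then 1 else 0 := by
  have := IsFiniteTensorCategory.finiteDimensional_hom (k := k) (C := C)
  rw [(exists_isProjectiveCover k i).choose_spec.finrank_hom k]
  refine if_congr ⟨fun ⟨e⟩ => SimpleClass.eq_of_iso e, ?_⟩ rfl rfl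
  rintro rfl
  exact ⟨Iso.refl _⟩

include k in
theorem isAdditiveOnObjects_multiplicity (i : SimpleClass C) :
    IsAdditiveOnObjects fun X : C => (multiplicity X i.rep : ℝ) := by
  have := IsFiniteTensorCategory.finiteDimensional_hom (k := k) (C := C)
  simp only [multiplicity_rep k]
  exact isAdditiveOnObjects_finrank_hom k _

include k in
theorem multiplicity_of_shortExact (i : SimpleClass C) {S : ShortComplex C} (hS : S.ShortExact) :
    (multiplicity S.X₂ i.rep : ℝ) = multiplicity S.X₁ i.rep + multiplicity S.X₃ i.rep :=
  isAdditiveOnObjects_multiplicity k i S hS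

include k in
open Classical in
theorem multiplicity_rep_rep (i j : SimpleClass C) :
    multiplicity i.rep j.rep = if j = i then 1 else 0 := by
  rw [multiplicity_rep k, finrank_projectiveCover_rep]

variable [Fintype (SimpleClass C)]

include k in
/-- An additive function on a finite tensor category is determined by its values on simple
objects. -/
theorem IsAdditiveOnObjects.eq_sum {φ : C → ℝ} (h : IsAdditiveOnObjects φ) (X : C) :
    φ X = ∑ i : SimpleClass C, (multiplicity X i.rep : ℝ) * φ i.rep := by
  classical
  have hm := isAdditiveOnObjects_multiplicity k (C := C)
  obtain ⟨l, hl⟩ := IsFiniteTensorCategory.isFiniteLength (k := k) X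
  induction hl with
  | zero X hX => simp [h.eq_zero_of_isZero hX, fun i => (hm i).eq_zero_of_isZero hX]
  | cons S l hS hL _ ih =>
    obtain ⟨j, ⟨e⟩⟩ := SimpleClass.exists_iso_rep S.X₃
    have h3 : ∑ i : SimpleClass C, (multiplicity S.X₃ i.rep : ℝ) * φ i.rep = φ S.X₃ := by
      simp only [← fun i => (hm i).eq_of_iso e, ← h.eq_of_iso e, multiplicity_rep_rep k]
      simp
    rw [h S hS, ih, ← h3, ← Finset.sum_add_distrib]
    exact Finset.sum_congr rfl fun i _ => by
      rw [multiplicity_of_shortExact k i hS, add_mul]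

/-- A function on objects which is additive on direct sums is determined on projective objects by
its values on the indecomposable projective objects. -/
theorem eq_sum_of_projective {φ : C → ℝ} (hiso : ∀ {X Y : C}, (X ≅ Y) → φ X = φ Y)
    (hadd : ∀ X Y : C, φ (X ⊞ Y) = φ X + φ Y) (P : C) [Projective P] :
    φ P = ∑ i : SimpleClass C, (finrank k (P ⟶ i.rep) : ℝ) * φ (projectiveCover k C i) := by
  classical
  have := IsFiniteTensorCategory.finiteDimensional_hom (k := k) (C := C)
  have hzero {X : C} (hX : IsZero X) : φ X = 0 := by
    have h0 := hadd X X
    rw [hiso ((hX.iso (by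
      rw [IsZero.iff_id_eq_zero]
      ext <;> exact hX.eq_of_src _ _) : X ≅ X ⊞ X)).symm] at h0
    linarith
  -- Induction on the size of the top of `P`: a simple quotient of `P` lifts to its cover,
  -- essentiality makes the lift epi, and the cover splits off.
  induction hn : ∑ i : SimpleClass C, finrank k (P ⟶ i.rep) using Nat.strong_induction_on
    generalizing P with
  | _ n ih =>
    obtain h | ⟨L, _, f, _⟩ :=
      (IsFiniteTensorCategory.isFiniteLength (k := k) P).isZero_or_exists_epi
    · have h0 (i : SimpleClass C) : finrank k (P ⟶ i.rep) = 0 := by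
        have : Subsingleton (P ⟶ i.rep) := ⟨fun _ _ => h.eq_of_src _ _⟩
        exact Module.finrank_zero_of_subsingleton
      simp [hzero h, h0]
    · obtain ⟨j, ⟨e⟩⟩ := SimpleClass.exists_iso_rep L
      obtain ⟨p, hp⟩ := exists_isProjectiveCover k j
      have := hp.epi
      let g : P ⟶ projectiveCover k C j := Projective.factorThru (f ≫ e.inv) p
      have hg : g ≫ p = f ≫ e.inv := Projective.factorThru_comp _ _
      have : Epi g := hp.epi_of_epi_comp g (hg ▸ inferInstance)
      have hS := shortExact_of_epi g
      let E : P ≅ kernel g ⊞ projectiveCover k C j := hS.splittingOfProjective.isoBinaryBiproduct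
      have : Projective (kernel g ⊞ projectiveCover k C j) := .of_iso E inferInstance
      have : Projective (kernel g) :=
        (Retract.mk biprod.inl biprod.fst biprod.inl_fst :
          Retract (kernel g) (kernel g ⊞ projectiveCover k C j)).projective
      have hfin (i : SimpleClass C) : finrank k (P ⟶ i.rep) =
          finrank k (kernel g ⟶ i.rep) + if j = i then 1 else 0 := by
        rw [finrank_hom_congr k E (Iso.refl _), finrank_hom_biprod, finrank_projectiveCover_rep]
      have hlt : ∑ i : SimpleClass C, finrank k (kernel g ⟶ i.rep) < n := by
        rw [← hn]
        simp only [hfin, Finset.sum_add_distrib, Finset.sum_ite_eq, Finset.mem_univ, if_true]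
        omega
      rw [hiso E, hadd, ih _ hlt (kernel g) rfl]
      simp [hfin, add_mul, Finset.sum_add_distrib]

end Multiplicity

/-! ### The dimension function -/

section Dimension

/-- A dimension function: additive on short exact sequences, multiplicative for the tensor product
and positive on simple objects. -/
structure IsDimension {C : Type*} [Category* C] [Abelian C] [MonoidalCategory C]
    (d : C → ℝ) : Prop where
  isAdditiveOnObjects : IsAdditiveOnObjects d
  tensor : ∀ X Y : C, d (X ⊗ Y) = d X * d Y
  pos_of_simple : ∀ L : C, Simple L → 0 < d L

variable (k : Type*) [Field k] {C : Type*} [Category* C] [Abelian C] [Linear k C]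
  [MonoidalCategory C] [IsFiniteTensorCategory k C]

namespace IsDimension

variable [IsAlgClosed k] {d : C → ℝ}

include k

theorem nonneg (hd : IsDimension d) (X : C) : 0 ≤ d X := by
  have := IsFiniteTensorCategory.finite_simpleClass (k := k) (C := C)
  have := Fintype.ofFinite (SimpleClass C)
  rw [hd.isAdditiveOnObjects.eq_sum k X]
  exact Finset.sum_nonneg fun i _ =>
    mul_nonneg (Nat.cast_nonneg _) (hd.pos_of_simple _ i.2).le

theorem pos (hd : IsDimension d) {X : C} (hX : ¬ IsZero X) : 0 < d X := by
  obtain h | ⟨L, hL, f, _⟩ :=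
    (IsFiniteTensorCategory.isFiniteLength (k := k) X).isZero_or_exists_epi
  · exact absurd h hX
  · have h := hd.isAdditiveOnObjects _ (shortExact_of_epi f)
    simp only at h
    linarith [hd.nonneg k (kernel f), hd.pos_of_simple L hL]

end IsDimension

variable [MonoidalPreadditive C] [RigidCategory C]

include k in
/-- If every object of `C` is a quotient of an object in the image of `F`, then some `F.obj X` is
such that every simple object occurs in the product with it of any simple object. -/
theorem exists_epi_tensor_obj {B : Type*} [Category* B] (F : B ⥤ C)
    (hF : ∀ Y : C, ∃ (X : B) (f : F.obj X ⟶ Y), Epi f) :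
    ∃ X : B, ∀ i j : SimpleClass C, ∃ f : i.rep ⊗ F.obj X ⟶ j.rep, Epi f := by
  classical
  have := IsFiniteTensorCategory.finite_simpleClass (k := k) (C := C)
  have := Abelian.hasFiniteBiproducts (C := C)
  -- Covering all `ᘁL_i ⊗ L_j` at once lets `L_i ⊗ F X` map onto `L_i ⊗ ᘁL_i ⊗ L_j`, and evaluation,
  -- epi because the unit is simple, maps this onto `L_j`.
  obtain ⟨X, f, hf⟩ := hF (⨁ fun p : SimpleClass C × SimpleClass C => (ᘁp.1.rep) ⊗ p.2.rep)
  refine ⟨X, fun i j => ?_⟩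
  have := simple_unit k (C := C)
  have hε : Epi (ε_ (ᘁi.rep) i.rep) :=
    epi_of_nonzero_to_simple (evaluation_ne_zero (Simple.not_isZero i.rep))
  let g : F.obj X ⟶ (ᘁi.rep) ⊗ j.rep :=
    f ≫ biproduct.π (fun p : SimpleClass C × SimpleClass C => (ᘁp.1.rep) ⊗ p.2.rep) (i, j)
  have hg : Epi g := epi_comp _ _
  have h1 : Epi (i.rep ◁ g) := inferInstanceAs (Epi ((tensorLeft _).map g))
  have h2 : Epi (ε_ (ᘁi.rep) i.rep ▷ j.rep) := inferInstanceAs (Epi ((tensorRight _).map _))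
  exact ⟨i.rep ◁ g ≫ (α_ _ _ _).inv ≫ ε_ (ᘁi.rep) i.rep ▷ j.rep ≫ (λ_ _).hom, inferInstance⟩

variable [IsAlgClosed k]

namespace IsDimension

variable {d : C → ℝ}

include k

variable (C) in
/-- The Frobenius-Perron theorem for the Grothendieck ring: a dimension function exists. -/
theorem exists_isDimension : ∃ d : C → ℝ, IsDimension d := by
  classical
  have := IsFiniteTensorCategory.finite_simpleClass (k := k) (C := C)
  have := Fintype.ofFinite (SimpleClass C)
  have := nonempty_simpleClass k (C := C)
  obtain ⟨Z, hZ⟩ := exists_epi_tensor_obj k (𝟭 C) fun Y => ⟨Y, 𝟙 Y, inferInstanceAs (Epi (𝟙 Y))⟩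
  let A : Matrix (SimpleClass C) (SimpleClass C) ℝ := fun i j => multiplicity (i.rep ⊗ Z) j.rep
  have hA (i j : SimpleClass C) : 0 < A i j := by
    obtain ⟨f, hf⟩ := hZ i j
    exact Nat.cast_pos.2 (multiplicity_rep_pos_of_epi k f)
  obtain ⟨w, r, hw, hAw⟩ := exists_pos_eigenvector hA
  let φ : C → ℝ := fun X => ∑ j : SimpleClass C, (multiplicity X j.rep : ℝ) * w j
  have hφ : IsAdditiveOnObjects φ := fun S hS => by
    simp only [φ, ← Finset.sum_add_distrib]
    exact Finset.sum_congr rfl fun j _ => by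
      rw [multiplicity_of_shortExact k j hS, add_mul]
  have hφw (i : SimpleClass C) : φ i.rep = w i := by
    simp [φ, multiplicity_rep_rep k]
  have hφpos (L : C) (_ : Simple L) : 0 < φ L := by
    obtain ⟨i, ⟨e⟩⟩ := SimpleClass.exists_iso_rep L
    rw [← hφ.eq_of_iso e, hφw]
    exact hw i
  have hφZ (X : C) : φ (X ⊗ Z) = r * φ X := by
    rw [(isAdditiveOnObjects_tensor_right hφ Z).eq_sum k X, hφ.eq_sum k X, Finset.mul_sum]
    refine Finset.sum_congr rfl fun i _ => ?_
    rw [mul_left_comm, hφw, ← smul_eq_mul r, ← Pi.smul_apply, ← hAw]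
    rfl
  -- Left multiplication by `X` commutes with right multiplication by `Z`, so it preserves the
  -- eigenline spanned by `φ`.
  have hmul (X : C) : ∃ c : ℝ, ∀ Y : C, φ (X ⊗ Y) = c * φ Y := by
    have hX := isAdditiveOnObjects_tensor_left hφ X
    obtain ⟨c, hc⟩ := eq_smul_of_pos_eigenvector hA (u := fun i => φ (X ⊗ i.rep)) hw hAw (by
      ext i
      rw [Pi.smul_apply, smul_eq_mul, ← hφZ, hφ.eq_of_iso (α_ X i.rep Z), hX.eq_sum k]
      rfl)
    refine ⟨c, fun Y => ?_⟩
    rw [hX.eq_sum k Y, hφ.eq_sum k Y, Finset.mul_sum]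
    refine Finset.sum_congr rfl fun i _ => ?_
    rw [mul_left_comm, hφw]
    exact congrArg _ (congrFun hc i)
  have h1 : 0 < φ (𝟙_ C) := hφpos _ (simple_unit k)
  refine ⟨fun X => φ X / φ (𝟙_ C), fun S hS => ?_, fun X Y => ?_,
    fun L hL => div_pos (hφpos L hL) h1⟩
  · simp only [hφ S hS, add_div]
  · obtain ⟨c, hc⟩ := hmul X
    have : φ X = c * φ (𝟙_ C) := by rw [← hc, hφ.eq_of_iso (ρ_ X)]
    rw [hc, this]
    field_simp

/-- A dimension function is given by the Frobenius-Perron dimension. -/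
theorem FPdim_eq (hd : IsDimension d) (X : C) : FPdim k X = d X := by
  classical
  have := IsFiniteTensorCategory.finite_simpleClass (k := k) (C := C)
  let := Fintype.ofFinite (SimpleClass C)
  have := nonempty_simpleClass k (C := C)
  -- Multiplicativity says that the values of `d` on simples form a positive left eigenvector with
  -- eigenvalue `d X`.
  refine (isGreatest_eigenvalue_of_pos_vecMul (N := leftMulMatrix X) (w := fun i => d i.rep)
    (fun _ _ => Nat.cast_nonneg _) (fun i => hd.pos_of_simple _ i.2) ?_).csSup_eq
  ext i
  rw [Pi.smul_apply, smul_eq_mul, ← hd.tensor, hd.isAdditiveOnObjects.eq_sum k (X ⊗ i.rep)]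
  exact Finset.sum_congr rfl fun j _ => mul_comm _ _

end IsDimension

end Dimension

end

end FinTensor

namespace FinTensor

noncomputable section

open Module

/-! ### Stable equivalences -/

section Stable

variable {C D : Type*} [Category* C] [Abelian C] [Category* D] [Abelian D]

theorem projective_of_stableRel_id_zero {X : C} (h : stableRel C (𝟙 X) 0) : Projective X := by
  obtain ⟨P, _, i, j, hij⟩ := h
  exact (Retract.mk i j (by rw [hij, sub_zero]) : Retract X P).projective

variable (F : C ⥤ D) [F.Additive] [F.PreservesProjectiveObjects]

theorem projective_of_isZero_obj [(stableFunctor F).Faithful] {X : C} (h : IsZero (F.obj X)) :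
    Projective X := by
  refine projective_of_stableRel_id_zero ((Quotient.functor_map_eq_iff (stableRel C) _ _).1 ?_)
  refine (stableFunctor F).map_injective ?_
  exact congrArg (Quotient.functor (stableRel D)).map (h.eq_of_src (F.map (𝟙 X)) (F.map 0))

/-- Lift a stable isomorphism `F A ≅ L` to a morphism; if it were zero, the identity of `L` would be
stably zero and `L` projective. -/
theorem exists_epi_obj_of_simple [(stableFunctor F).EssSurj] {L : D} [Simple L]
    (hL : ¬ Projective L) : ∃ (X : C) (f : F.obj X ⟶ L), Epi f := by
  let A := (stableFunctor F).objPreimage ⟨L⟩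
  let e : (Quotient.functor (stableRel D)).obj (F.obj A.as) ≅
      (Quotient.functor (stableRel D)).obj L :=
    (stableFunctor F).objObjPreimageIso ⟨L⟩
  obtain ⟨g, hg⟩ := (Quotient.functor (stableRel D)).map_surjective e.hom
  obtain ⟨f, hf⟩ := (Quotient.functor (stableRel D)).map_surjective e.inv
  refine ⟨A.as, g, epi_of_nonzero_to_simple fun h0 => hL (projective_of_stableRel_id_zero
    ((Quotient.functor_map_eq_iff (stableRel D) _ _).1 ?_))⟩
  rw [CategoryTheory.Functor.map_id, ← e.inv_hom_id, ← hf, ← hg, ← Functor.map_comp, h0, comp_zero]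

end Stable

/-! ### Exact functors -/

section Exact

open scoped ZeroObject

variable {C D : Type*} [Category* C] [Abelian C] [Category* D] [Abelian D]
  (F : C ⥤ D)

theorem not_isZero_obj_of_simple [PreservesFiniteColimits F] (hlen : ∀ X : C, IsFiniteLength X)
    (hF : ∀ L : C, Simple L → ¬ IsZero (F.obj L)) {X : C} (hX : ¬ IsZero X) :
    ¬ IsZero (F.obj X) := by
  obtain h | ⟨L, hL, f, _⟩ := (hlen X).isZero_or_exists_epi
  · exact absurd h hX
  · exact fun h => hF L hL (h.of_epi (F.map f))

variable [F.Additive]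

/-- By exactness, a morphism killed by `F` has its image killed by `F`. -/
theorem faithful_of_not_isZero_obj [PreservesFiniteLimits F] [PreservesFiniteColimits F]
    (hF : ∀ X : C, ¬ IsZero X → ¬ IsZero (F.obj X)) : F.Faithful := by
  refine ⟨fun {X Y f g} h => sub_eq_zero.1 ?_⟩
  rw [← sub_eq_zero, ← F.map_sub] at h
  generalize f - g = f at h ⊢
  rw [← image.fac f, F.map_comp] at h
  have h0 : F.map (factorThruImage f) = 0 := by
    rwa [← cancel_mono (F.map (image.ι f)), zero_comp]
  by_contra hne
  refine hF (image f) (fun hz => hne ?_) (IsZero.of_epi_eq_zero _ h0)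
  rw [← image.fac f, hz.eq_of_src (image.ι f) 0, comp_zero]

/-- If every simple object is a quotient of an object in the image of the exact functor `F`, then
every object of finite length is. -/
theorem exists_epi_obj_of_hasCompositionFactors [F.PreservesProjectiveObjects]
    [PreservesFiniteColimits F] [EnoughProjectives C]
    (hF : ∀ L : D, Simple L → ∃ (X : C) (f : F.obj X ⟶ L), Epi f) {Y : D} {l : List D}
    (h : HasCompositionFactors Y l) : ∃ (X : C) (f : F.obj X ⟶ Y), Epi f := by
  induction h with
  | zero Y hY => exact ⟨0, 0, ⟨fun _ _ _ => hY.eq_of_src _ _⟩⟩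
  | cons S l hS hL _ ih =>
    obtain ⟨X, f, _⟩ := ih
    obtain ⟨X', f', _⟩ := hF _ hL
    have := hS.epi_g
    have := hS.mono_f
    -- As in the horseshoe lemma: `F` keeps the cover of `X'` projective, so its map to the top
    -- factor lifts to `S.X₂`.
    let p : F.obj (Projective.over X') ⟶ S.X₃ := F.map (Projective.π X') ≫ f'
    have : Projective (F.obj (Projective.over X')) := F.projective_obj _
    let q : F.obj (Projective.over X') ⟶ S.X₂ := Projective.factorThru p S.g
    have hq : q ≫ S.g = p := Projective.factorThru_comp p S.g
    have hp : Epi p := epi_comp _ _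
    refine ⟨X ⊞ Projective.over X',
      F.map biprod.fst ≫ f ≫ S.f + F.map biprod.snd ≫ q, ?_⟩
    refine Preadditive.epi_of_cancel_zero _ fun {Z} a ha => ?_
    have h1 : S.f ≫ a = 0 := by
      have := congrArg (F.map biprod.inl ≫ ·) ha
      simp only [Preadditive.comp_add, Preadditive.add_comp, ← F.map_comp_assoc, Category.assoc,
        biprod.inl_fst, biprod.inl_snd, F.map_id, F.map_zero, zero_comp, add_zero,
        Category.id_comp, comp_zero] at this
      rwa [← cancel_epi f, comp_zero]
    have h2 : q ≫ a = 0 := by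
      have := congrArg (F.map biprod.inr ≫ ·) ha
      simpa only [Preadditive.comp_add, Preadditive.add_comp, ← F.map_comp_assoc, Category.assoc,
        biprod.inr_fst, biprod.inr_snd, F.map_id, F.map_zero, zero_comp, zero_add,
        Category.id_comp, comp_zero] using this
    have h3 : S.g ≫ hS.exact.desc a h1 = a := hS.exact.g_desc a h1
    have h4 : hS.exact.desc a h1 = 0 := by
      rw [← cancel_epi p, ← hq, Category.assoc, h3, h2, comp_zero]
    rw [← h3, h4, comp_zero]

/-- Lift the composite with a projective presentation of the source; faithfulness shows that the
lift kills the kernel, so it descends. -/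
theorem full_of_surjective_of_projective [F.Faithful] [PreservesFiniteColimits F]
    [EnoughProjectives C]
    (h : ∀ (P X : C) [Projective P], Function.Surjective (F.map : (P ⟶ X) → _)) : F.Full := by
  refine ⟨fun {Y X} f => ?_⟩
  obtain ⟨g, hg⟩ := h (Projective.over Y) X (F.map (Projective.π Y) ≫ f)
  have h0 : kernel.ι (Projective.π Y) ≫ g = 0 := F.map_injective (by
    rw [F.map_comp, hg, ← F.map_comp_assoc, kernel.condition, F.map_zero, zero_comp, F.map_zero])
  refine ⟨Abelian.epiDesc _ g h0, ?_⟩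
  rw [← cancel_epi (F.map (Projective.π Y)), ← F.map_comp, Abelian.comp_epiDesc, hg]

/-- Each `Y` is the cokernel of some `F X₁ ⟶ F X₀`; by fullness this map comes from the source, and
`F` preserves its cokernel. -/
theorem essSurj_of_exists_epi [F.Full] [PreservesFiniteColimits F]
    (h : ∀ Y : D, ∃ (X : C) (f : F.obj X ⟶ Y), Epi f) : F.EssSurj := by
  refine ⟨fun Y => ?_⟩
  obtain ⟨X₀, f, _⟩ := h Y
  obtain ⟨X₁, g, _⟩ := h (kernel f)
  let r : X₁ ⟶ X₀ := F.preimage (g ≫ kernel.ι f)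
  have hr : F.map r = g ≫ kernel.ι f := F.map_preimage _
  let e₁ : cokernel (g ≫ kernel.ι f) ≅ cokernel (kernel.ι f) := cokernelEpiComp g (kernel.ι f)
  let e₂ : cokernel (kernel.ι f) ≅ Y :=
    (colimit.isColimit _).coconePointUniqueUpToIso
      (Abelian.epiIsCokernelOfKernel _ (kernelIsKernel f))
  exact ⟨cokernel r, ⟨PreservesCokernel.iso F r ≪≫ cokernelIsoOfEq hr ≪≫ e₁ ≪≫ e₂⟩⟩

end Exact

/-! ### The regular projective object -/

section Regular

variable (k : Type*) [Field k] {C : Type*} [Category* C] [Abelian C] [MonoidalCategory C]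
  {D : Type*} [Category* D] [Abelian D] [Linear k D] [MonoidalCategory D]
  [IsFiniteTensorCategory k D] (F : C ⥤ D)

theorem IsDimension.comp {d : D → ℝ} [IsAlgClosed k] [F.Additive] [F.Monoidal]
    [PreservesFiniteLimits F] [PreservesFiniteColimits F] (hd : IsDimension d)
    (hF : ∀ L : C, Simple L → ¬ IsZero (F.obj L)) : IsDimension fun X => d (F.obj X) where
  isAdditiveOnObjects := hd.isAdditiveOnObjects.comp F
  tensor X Y := by
    rw [← hd.tensor, hd.isAdditiveOnObjects.eq_of_iso (Functor.Monoidal.μIso F X Y)]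
  pos_of_simple L hL := hd.pos k (hF L hL)

variable [Linear k C] [IsFiniteTensorCategory k C] [Fintype (SimpleClass C)]

/-- In `P` this dimension is additive on direct sums, which suffices to decompose projectives. -/
theorem finrank_hom_obj_of_projective [F.Additive] [IsAlgClosed k] (P : C) [Projective P]
    (Y : D) :
    (finrank k (F.obj P ⟶ Y) : ℝ) = ∑ i : SimpleClass C, (finrank k (P ⟶ i.rep) : ℝ) *
      finrank k (F.obj (projectiveCover k C i) ⟶ Y) := by
  have := IsFiniteTensorCategory.finiteDimensional_hom (k := k) (C := D)
  have := preservesBinaryBiproducts_of_preservesBiproducts F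
  refine eq_sum_of_projective k (φ := fun P : C => (finrank k (F.obj P ⟶ Y) : ℝ))
    (fun e => ?_) (fun A B => ?_) P
  · rw [finrank_hom_congr k (F.mapIso e) (Iso.refl Y)]
  · rw [finrank_hom_congr k (F.mapBiprod A B) (Iso.refl Y), finrank_hom_biprod, Nat.cast_add]

/-- The dimension of the space of morphisms from the image of the regular projective object, the
formal sum of the indecomposable projective objects weighted by the dimensions of their tops. -/
def regularHomDim (d : C → ℝ) (Y : D) : ℝ :=
  ∑ i : SimpleClass C, d i.rep * finrank k (F.obj (projectiveCover k C i) ⟶ Y)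

theorem isAdditiveOnObjects_regularHomDim [F.PreservesProjectiveObjects] (d : C → ℝ) :
    IsAdditiveOnObjects (regularHomDim k F d) := fun S hS => by
  have := IsFiniteTensorCategory.finiteDimensional_hom (k := k) (C := D)
  have (i : SimpleClass C) : Projective (F.obj (projectiveCover k C i)) := F.projective_obj _
  simp only [regularHomDim, ← Finset.sum_add_distrib]
  exact Finset.sum_congr rfl fun i _ => by
    rw [finrank_hom_of_shortExact k _ hS, Nat.cast_add, mul_add]

theorem surjective_map_of_projective [IsAlgClosed k] [F.Additive] [F.Linear k]
    [F.Faithful] {d : C → ℝ} (hd : IsDimension d)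
    (h : ∀ X : C, regularHomDim k F d (F.obj X) = d X) (P X : C) [Projective P] :
    Function.Surjective (F.map : (P ⟶ X) → _) := by
  have := IsFiniteTensorCategory.finiteDimensional_hom (k := k) (C := C)
  have := IsFiniteTensorCategory.finiteDimensional_hom (k := k) (C := D)
  have hinj (Q : C) : Function.Injective (F.mapLinearMap k : (Q ⟶ X) →ₗ[k] _) := F.map_injective
  have hX := h X
  rw [hd.isAdditiveOnObjects.eq_sum k X, regularHomDim] at hX
  simp only [multiplicity_rep k, mul_comm (d _)] at hX
  -- Faithfulness gives an inequality in each term; equal totals with positive weights force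
  -- equality term by term.
  have hP (i : SimpleClass C) := (Finset.sum_eq_sum_iff_of_le fun (i : SimpleClass C) _ =>
    mul_le_mul_of_nonneg_right
      (Nat.cast_le.2 (LinearMap.finrank_le_finrank_of_injective (hinj (projectiveCover k C i))))
      (hd.pos_of_simple _ i.2).le).1 hX.symm i (Finset.mem_univ i)
  have heq : finrank k (P ⟶ X) = finrank k (F.obj P ⟶ F.obj X) := by
    have h1 := finrank_hom_obj_of_projective k F P (F.obj X)
    have h2 := finrank_hom_obj_of_projective k (𝟭 C) P X
    simp only [Functor.id_obj] at h2
    rw [← Nat.cast_inj (R := ℝ), h1, h2]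
    refine Finset.sum_congr rfl fun i _ => ?_
    rw [mul_right_cancel₀ (hd.pos_of_simple _ i.2).ne' (hP i)]
  exact (LinearMap.injective_iff_surjective_of_finrank_eq_finrank heq).1 (hinj P)

variable [IsAlgClosed k] [Fintype (SimpleClass D)]

/-- The Frobenius-Perron dimension of the source is the total dimension of the image of the
regular projective object. -/
theorem sum_dim_projectiveCover_eq [F.PreservesProjectiveObjects] {d : D → ℝ}
    (hd : IsDimension d) :
    ∑ i : SimpleClass C, d (F.obj i.rep) * d (F.obj (projectiveCover k C i)) =
      ∑ j : SimpleClass D, regularHomDim k F (fun X => d (F.obj X)) j.rep *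
        d (projectiveCover k D j) := by
  have (i : SimpleClass C) : Projective (F.obj (projectiveCover k C i)) := F.projective_obj _
  simp only [fun i : SimpleClass C => eq_sum_of_projective k (φ := d)
    hd.isAdditiveOnObjects.eq_of_iso hd.isAdditiveOnObjects.biprod
    (F.obj (projectiveCover k C i)), regularHomDim, Finset.mul_sum, Finset.sum_mul]
  rw [Finset.sum_comm]
  exact Finset.sum_congr rfl fun j _ => Finset.sum_congr rfl fun i _ => by ring

end Regular

/-! ### Tensor functors -/

section TensorFunctor

variable (k : Type*) [Field k] {C : Type*} [Category* C] [Abelian C] [Linear k C]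
  [MonoidalCategory C] [MonoidalPreadditive C] [MonoidalLinear k C] [RigidCategory C]
  [IsFiniteTensorCategory k C]

variable {D : Type*} [Category* D] [Abelian D] [Linear k D]
  [MonoidalCategory D] [MonoidalPreadditive D] [MonoidalLinear k D]
  [IsFiniteTensorCategory k D] (F : C ⥤ D) [F.Additive] [F.Monoidal]

variable [IsAlgClosed k] [Fintype (SimpleClass C)]

/-- Move `F X` across by duality to get Hom(F(P_i ⊗ ᘁX), Y), then decompose the projective `P_i ⊗
ᘁX`; the same duality in `C` turns its coefficients into multiplicities. -/
theorem finrank_hom_obj_projectiveCover_tensor (i : SimpleClass C) (X : C) (Y : D) :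
    (finrank k (F.obj (projectiveCover k C i) ⟶ Y ⊗ F.obj X) : ℝ) =
      ∑ l : SimpleClass C, (multiplicity (l.rep ⊗ X) i.rep : ℝ) *
        finrank k (F.obj (projectiveCover k C l) ⟶ Y) := by
  let := exactPairingMap F (ᘁX) X
  rw [← finrank_hom_tensor k _ (F.obj (ᘁX)) (F.obj X),
    finrank_hom_congr k (Functor.Monoidal.μIso F (projectiveCover k C i) (ᘁX)) (Iso.refl Y),
    finrank_hom_obj_of_projective]
  simp only [finrank_hom_tensor k _ (ᘁX) X, multiplicity_rep k]

/-- Summing the previous formula with weights d(L_i) collapses the multiplicities to d(L_l ⊗ X) =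
d(L_l) d(X). -/
theorem regularHomDim_tensor {d : C → ℝ} (hd : IsDimension d) (X : C) (Y : D) :
    regularHomDim k F d (Y ⊗ F.obj X) = d X * regularHomDim k F d Y := by
  simp only [regularHomDim, finrank_hom_obj_projectiveCover_tensor, Finset.mul_sum]
  rw [Finset.sum_comm]
  refine Finset.sum_congr rfl fun l _ => ?_
  rw [← mul_assoc, mul_comm (d X), ← hd.tensor, hd.isAdditiveOnObjects.eq_sum k (l.rep ⊗ X),
    Finset.sum_mul]
  exact Finset.sum_congr rfl fun i _ => by ring

variable [RigidCategory D] [Fintype (SimpleClass D)]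

/-- For a surjective tensor functor preserving projective objects, the image of the regular
projective object is proportional to the regular projective object. -/
theorem exists_regularHomDim_eq [F.PreservesProjectiveObjects]
    (hF : ∀ Y : D, ∃ (X : C) (f : F.obj X ⟶ Y), Epi f) {d : D → ℝ} (hd : IsDimension d)
    (hdF : IsDimension fun X => d (F.obj X)) :
    ∃ c : ℝ, ∀ Y : D, regularHomDim k F (fun X => d (F.obj X)) Y = c * d Y := by
  set u := regularHomDim k F fun X => d (F.obj X) with hu
  have hadd : IsAdditiveOnObjects u := isAdditiveOnObjects_regularHomDim k F _
  obtain ⟨Z, hZ⟩ := exists_epi_tensor_obj k F hF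
  let A : Matrix (SimpleClass D) (SimpleClass D) ℝ :=
    fun i j => multiplicity (i.rep ⊗ F.obj Z) j.rep
  have hA (i j : SimpleClass D) : 0 < A i j := by
    obtain ⟨f, hf⟩ := hZ i j
    exact Nat.cast_pos.2 (multiplicity_rep_pos_of_epi k f)
  -- Both `d` and `u` are eigenvectors for right multiplication by `F Z`, with the same eigenvalue
  -- `d (F Z)`.
  obtain ⟨c, hc⟩ := eq_smul_of_pos_eigenvector hA (w := fun i => d i.rep) (u := fun i => u i.rep)
    (r := d (F.obj Z)) (fun i => hd.pos_of_simple _ i.2)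
    (by
      ext i
      rw [Pi.smul_apply, smul_eq_mul, mul_comm, ← hd.tensor, hd.isAdditiveOnObjects.eq_sum k]
      rfl)
    (by
      ext i
      rw [Pi.smul_apply, smul_eq_mul, hu, ← regularHomDim_tensor k F hdF, ← hu, hadd.eq_sum k]
      rfl)
  refine ⟨c, fun Y => ?_⟩
  rw [hadd.eq_sum k, hd.isAdditiveOnObjects.eq_sum k, Finset.mul_sum]
  refine Finset.sum_congr rfl fun i _ => ?_
  rw [mul_left_comm]
  exact congrArg _ (congrFun hc i)

end TensorFunctor

end

end FinTensor

/-! ### Conclusion: equal dimensions force the proportionality constant to be 1. -/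

theorem theorem1p2 {k : Type*} [Field k] [IsAlgClosed k]
    {C : Type*} [Category* C] [Abelian C] [Linear k C]
    [MonoidalCategory C] [MonoidalPreadditive C] [MonoidalLinear k C] [RigidCategory C]
    [FinTensor.IsFiniteTensorCategory k C]
    {C' : Type*} [Category* C'] [Abelian C'] [Linear k C']
    [MonoidalCategory C'] [MonoidalPreadditive C'] [MonoidalLinear k C'] [RigidCategory C']
    [FinTensor.IsFiniteTensorCategory k C']
    (hC : ¬ FinTensor.IsSemisimple C) (hC' : ¬ FinTensor.IsSemisimple C')
    (hproj : ∀ L : C, Simple L → ¬ Projective L)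
    (hproj' : ∀ L : C', Simple L → ¬ Projective L)
    (hdim : FinTensor.categoryFPdim k C = FinTensor.categoryFPdim k C')
    (F : C ⥤ C') [F.Additive] [F.Linear k] [F.Monoidal]
    [PreservesFiniteLimits F] [PreservesFiniteColimits F]
    (hF : FinTensor.InducesStableEquivalence F) :
    FinTensor.IsTensorEquivalence k F := by
  open FinTensor in
  obtain ⟨_, _⟩ := hF
  have := enoughProjectives k (C := C)
  have := IsFiniteTensorCategory.finite_simpleClass (k := k) (C := C)
  have := IsFiniteTensorCategory.finite_simpleClass (k := k) (C := C')
  let := Fintype.ofFinite (SimpleClass C)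
  let := Fintype.ofFinite (SimpleClass C')
  have hzero (L : C) (hL : Simple L) : ¬ IsZero (F.obj L) := fun h =>
    hproj L hL (projective_of_isZero_obj F h)
  have : F.Faithful := faithful_of_not_isZero_obj F fun _ =>
    not_isZero_obj_of_simple F (IsFiniteTensorCategory.isFiniteLength (k := k)) hzero
  have hsurj (Y : C') : ∃ (X : C) (f : F.obj X ⟶ Y), Epi f :=
    exists_epi_obj_of_hasCompositionFactors F
      (fun L hL => exists_epi_obj_of_simple F (hproj' L hL))
      (IsFiniteTensorCategory.isFiniteLength (k := k) Y).choose_spec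
  obtain ⟨d, hd⟩ := IsDimension.exists_isDimension k C'
  have hdF := hd.comp k F hzero
  obtain ⟨c, hc⟩ := exists_regularHomDim_eq k F hsurj hd hdF
  have hdimC : categoryFPdim k C =
      ∑ i : SimpleClass C, d (F.obj i.rep) * d (F.obj (projectiveCover k C i)) :=
    Finset.sum_congr rfl fun i _ => by rw [hdF.FPdim_eq k, hdF.FPdim_eq k]
  have hdimC' : categoryFPdim k C' =
      ∑ j : SimpleClass C', d j.rep * d (projectiveCover k C' j) :=
    Finset.sum_congr rfl fun i _ => by rw [hd.FPdim_eq k, hd.FPdim_eq k]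
  have hpos : 0 < ∑ j : SimpleClass C', d j.rep * d (projectiveCover k C' j) := by
    have := nonempty_simpleClass k (C := C')
    exact Finset.sum_pos (fun j _ => mul_pos (hd.pos_of_simple _ j.2)
      (hd.pos k (not_isZero_projectiveCover k j))) Finset.univ_nonempty
  have hc1 : c = 1 := by
    rw [hdimC, hdimC', sum_dim_projectiveCover_eq k F hd] at hdim
    simp only [hc, mul_assoc, ← Finset.mul_sum] at hdim
    exact (mul_eq_right₀ hpos.ne').1 hdim
  have : F.Full := full_of_surjective_of_projective F fun P X _ =>
    surjective_map_of_projective k F hdF (fun X => by rw [hc, hc1, one_mul]) P X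
  have : F.EssSurj := essSurj_of_exists_epi F hsurj
  exact { }
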